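/- Let $X$ be a Tychonoff space. Let $C_p(X)$ be the set of all continuous functions $X\to\mathbb{R}$; let $B_1(X)$ be the set of all functions $X\to\mathbb{R}$ of Baire class 1, i.e. pointwise limits of sequences of continuous functions $X\to\mathbb{R}$; and let $USC_p^f(X)$ be the set of all functions $f:X\to\mathbb{R}$ such that $f^{-1}((-\infty,r))$ is a cozero-set of $X$ (the complement of $g^{-1}(0)$ for some continuous $g:X\to\mathbb{R}$) for every $r\in\mathbb{R}$. All three carry the topology of pointwise convergence. Call a topological space $Y$ sequentially separable if it has a countable subset $D$ such that every point of $Y$ is the limit of a sequence of points of $D$. If $USC_p^f(X)$ is sequentially separable, then both $C_p(X)$ and $B_1(X)$ are sequentially separable. -/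

import Mathlib

open Filter Topology

/-- A space is sequentially separable if it has a countable subset `D` whose sequential closure
(the set of all limits of sequences of points of `D`) is the whole space. -/
def IsSequentiallySeparable (Y : Type*) [TopologicalSpace Y] : Prop :=
  ∃ D : Set Y, D.Countable ∧ seqClosure D = Set.univ

/-- A zero-set: the preimage of zero under a continuous real-valued function on `X`. -/
def IsZeroSetOf {X : Type*} [TopologicalSpace X] (Z : Set X) : Prop :=
  ∃ g : X → ℝ, Continuous g ∧ Z = g ⁻¹' {0}

/-- A cozero-set: the complement of a zero-set. -/
def IsCozeroSetOf {X : Type*} [TopologicalSpace X] (U : Set X) : Prop :=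
  IsZeroSetOf Uᶜ

/-- `C(X)` as a subset of `ℝ^X`. As a subtype of `X → ℝ` it carries the topology of pointwise
convergence, and so it is the space `C_p(X)`. -/
def CpSet (X : Type*) [TopologicalSpace X] : Set (X → ℝ) :=
  {f | Continuous f}

/-- The Baire functions of class 1, i.e. the pointwise limits of sequences of continuous functions.
As a subtype of `X → ℝ` the set carries the topology of pointwise convergence. -/
def BaireOneSet (X : Type*) [TopologicalSpace X] : Set (X → ℝ) :=
  {f | ∃ g : ℕ → X → ℝ, (∀ n, Continuous (g n)) ∧
    ∀ x, Tendsto (fun n => g n x) atTop (𝓝 (f x))}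

/-- `USC^f(X)`: the functions `f : X → ℝ` for which the preimage of `(-∞, r)` is a cozero-set for
every real `r`. As a subtype of `X → ℝ` the set carries the topology of pointwise convergence,
and so it is the space `USC_p^f(X)`. -/
def USCfSet (X : Type*) [TopologicalSpace X] : Set (X → ℝ) :=
  {f | ∀ r : ℝ, IsCozeroSetOf (f ⁻¹' Set.Iio r)}

/-! If `d n` tends pointwise to the indicator of a zero-set `Z`, then `Z` is the union over `n` of
the intersections of `{d m ≥ 1/2}`, `m ≥ n`, and each `{d m ≥ 1/2}` is a zero-set. A countable
witness `D` thus yields a countable `G ⊆ C(X)` whose zero-sets generate every zero-set. Let `S` be a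
countable sup-closed subring containing `G` and the rational constants. A Baire-one `f` is within
`ε` of a countably valued step function on pieces cut out by `G`, and that function is an eventually
constant limit from `S`. Truncated corrections and a diagonal sequence then reach `f` itself. As `S
⊆ C(X) ⊆ B₁(X)`, the same `S` serves both spaces. -/

/-- A countable set is contained in a countable set closed under countably many binary
operations. -/
theorem exists_countable_superset_closed {α ι : Type*} [Countable ι] (F : ι → α → α → α)
    {s : Set α} (hs : s.Countable) :
    ∃ t : Set α, s ⊆ t ∧ t.Countable ∧ ∀ i, ∀ a ∈ t, ∀ b ∈ t, F i a b ∈ t := by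
  let T : ℕ → Set α := fun n => Nat.rec s (fun _ A => A ∪ ⋃ i, Set.image2 (F i) A A) n
  have hT : ∀ n, T (n + 1) = T n ∪ ⋃ i, Set.image2 (F i) (T n) (T n) := fun n => rfl
  have hmono : Monotone T := monotone_nat_of_le_succ fun n => by
    rw [hT]
    exact Set.subset_union_left
  have hcount : ∀ n, (T n).Countable := by
    intro n
    induction n with
    | zero => exact hs
    | succ n ih =>
      rw [hT]
      exact ih.union (Set.countable_iUnion fun i => ih.image2 ih _)
  refine ⟨⋃ n, T n, Set.subset_iUnion T 0, Set.countable_iUnion hcount, ?_⟩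
  intro i a ha b hb
  obtain ⟨m, hm⟩ := Set.mem_iUnion.1 ha
  obtain ⟨n, hn⟩ := Set.mem_iUnion.1 hb
  refine Set.mem_iUnion.2 ⟨max m n + 1, ?_⟩
  rw [hT]
  exact Or.inr (Set.mem_iUnion.2 ⟨i, Set.mem_image2_of_mem (hmono (le_max_left m n) hm)
    (hmono (le_max_right m n) hn)⟩)

/-- A countable set in a ring with suprema is contained in a countable subring closed under
binary suprema. -/
theorem exists_countable_subring_sup {R : Type*} [Ring R] [Max R] {s : Set R}
    (hs : s.Countable) :
    ∃ S : Subring R, s ⊆ S ∧ (S : Set R).Countable ∧ ∀ a ∈ S, ∀ b ∈ S, a ⊔ b ∈ S := by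
  let F : Fin 3 → R → R → R := ![(· + ·), (· * ·), (· ⊔ ·)]
  obtain ⟨t, hst, ht, hF⟩ :=
    exists_countable_superset_closed F (hs.union (Set.toFinite ({0, 1, -1} : Set R)).countable)
  have hadd : ∀ a ∈ t, ∀ b ∈ t, a + b ∈ t := hF 0
  have hmul : ∀ a ∈ t, ∀ b ∈ t, a * b ∈ t := hF 1
  have hsup : ∀ a ∈ t, ∀ b ∈ t, a ⊔ b ∈ t := hF 2
  refine ⟨{ carrier := t
            mul_mem' := fun ha hb => hmul _ ha _ hb
            one_mem' := hst (by simp)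
            add_mem' := fun ha hb => hadd _ ha _ hb
            zero_mem' := hst (by simp)
            neg_mem' := fun {x} hx => ?_ }, Set.subset_union_left.trans hst, ht, hsup⟩
  have h := hmul (-1) (hst (by simp)) x hx
  simpa using h

section ZeroSets

variable {X : Type*} [TopologicalSpace X]

/-- The preimage of a closed subset of a metrizable space is a zero-set. -/
theorem IsClosed.isZeroSetOf_preimage {M : Type*} [TopologicalSpace M]
    [TopologicalSpace.MetrizableSpace M] {C : Set M} (hC : IsClosed C) {φ : X → M}
    (hφ : Continuous φ) : IsZeroSetOf (φ ⁻¹' C) := by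
  let := TopologicalSpace.metrizableSpaceMetric M
  rcases C.eq_empty_or_nonempty with rfl | hne
  · exact ⟨fun _ => 1, continuous_const, by ext; simp⟩
  · refine ⟨fun x => Metric.infDist (φ x) C, (Metric.continuous_infDist_pt C).comp hφ, ?_⟩
    ext x
    exact hC.mem_iff_infDist_zero hne

/-- The sets `{f < r}` are only `∅`, `Zᶜ` and `X`. -/
theorem IsZeroSetOf.indicator_one_mem_USCfSet {Z : Set X} (hZ : IsZeroSetOf Z) :
    Z.indicator (fun _ => (1 : ℝ)) ∈ USCfSet X := by
  classical
  intro r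
  unfold IsCozeroSetOf
  have huniv : IsZeroSetOf (Set.univ : Set X) := ⟨fun _ => 0, continuous_const, by ext; simp⟩
  have hempty : IsZeroSetOf (∅ : Set X) := ⟨fun _ => 1, continuous_const, by ext; simp⟩
  rw [Set.indicator_const_preimage_eq_union]
  by_cases h1 : (1 : ℝ) ∈ Set.Iio r
  · have h0 : (0 : ℝ) ∈ Set.Iio r := Set.mem_Iio.2 (zero_lt_one.trans (Set.mem_Iio.1 h1))
    simpa [h1, h0] using hempty
  · by_cases h0 : (0 : ℝ) ∈ Set.Iio r
    · simpa [h1, h0] using hZ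
    · simpa [h1, h0] using huniv

/-- If `USC^f(X)` is sequentially separable, then there are countably many continuous functions
such that every zero-set is a countable union of intersections of zero-sets of these functions. -/
theorem IsSequentiallySeparable.exists_countable_generators
    (h : IsSequentiallySeparable (USCfSet X)) :
    ∃ G : Set C(X, ℝ), G.Countable ∧ ∀ Z : Set X, IsZeroSetOf Z →
      ∃ p : ℕ → ℕ → C(X, ℝ), (∀ n k, p n k ∈ G) ∧ ∀ x, x ∈ Z ↔ ∃ n, ∀ k, p n k x = 0 := by
  obtain ⟨D, hD, hDuniv⟩ := h
  have hg : ∀ d : USCfSet X, ∃ g : C(X, ℝ), ∀ x, g x = 0 ↔ 1 / 2 ≤ d.1 x := by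
    intro d
    obtain ⟨g, hg, hgd⟩ := d.2 (1 / 2)
    refine ⟨⟨g, hg⟩, fun x => ?_⟩
    have hx := Set.ext_iff.1 hgd x
    simpa using hx.symm
  choose g hg using hg
  refine ⟨g '' D, hD.image g, fun Z hZ => ?_⟩
  have hmem : (⟨_, hZ.indicator_one_mem_USCfSet⟩ : USCfSet X) ∈ seqClosure D := by
    rw [hDuniv]
    trivial
  obtain ⟨d, hdD, hd⟩ := hmem
  rw [tendsto_subtype_rng, tendsto_pi_nhds] at hd
  -- The `n`-th intersection runs over the tail of `d` from index `n`.
  refine ⟨fun n k => g (d (n + k)), fun n k => ⟨_, hdD _, rfl⟩, fun x => ?_⟩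
  simp only [hg]
  have hx := hd x
  constructor
  · intro hxZ
    simp only [Set.indicator_of_mem hxZ] at hx
    obtain ⟨n, hn⟩ := eventually_atTop.1 (hx.eventually (lt_mem_nhds (by norm_num : (1 / 2 : ℝ) < 1)))
    exact ⟨n, fun k => (hn _ (Nat.le_add_right n k)).le⟩
  · rintro ⟨n, hn⟩
    by_contra hxZ
    simp only [Set.indicator_of_notMem hxZ] at hx
    have hle : (1 / 2 : ℝ) ≤ 0 := by
      refine ge_of_tendsto hx (eventually_atTop.2 ⟨n, fun m hm => ?_⟩)
      obtain ⟨k, rfl⟩ := Nat.exists_eq_add_of_le hm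
      exact hn k
    norm_num at hle

/-- The preimage of an open interval under a function of Baire class 1 is a countable union of
zero-sets. -/
theorem exists_isZeroSetOf_preimage_Ioo {f : X → ℝ} (hf : f ∈ BaireOneSet X) (a b : ℝ) :
    ∃ Z : ℕ → Set X, (∀ n, IsZeroSetOf (Z n)) ∧ f ⁻¹' Set.Ioo a b = ⋃ n, Z n := by
  obtain ⟨g, hg, hgf⟩ := hf
  -- The limit lies in `(a, b)` iff some tail stays in a slightly smaller closed interval; this is a
  -- closed condition in the metrizable space `ℕ → ℝ`.
  let C : ℕ → Set (ℕ → ℝ) := fun n =>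
    {y | ∀ k, y (n + k) ∈ Set.Icc (a + 1 / ((n : ℝ) + 1)) (b - 1 / ((n : ℝ) + 1))}
  have hC : ∀ n, IsClosed (C n) := by
    intro n
    simp only [C, Set.ofPred_forall]
    exact isClosed_iInter fun k => isClosed_Icc.preimage (continuous_apply _)
  refine ⟨fun n => (fun x k => g k x) ⁻¹' C n,
    fun n => (hC n).isZeroSetOf_preimage (continuous_pi hg), ?_⟩
  ext x
  simp only [Set.mem_preimage, Set.mem_iUnion, C, Set.mem_ofPred_eq]
  have hx := hgf x
  constructor
  · rintro ⟨h1, h2⟩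
    obtain ⟨a', ha, ha'⟩ := exists_between h1
    obtain ⟨b', hb', hb⟩ := exists_between h2
    have hev := hx.eventually (Icc_mem_nhds ha' hb')
    have h0 := tendsto_one_div_add_atTop_nhds_zero_nat (𝕜 := ℝ)
    have hε1 := h0.eventually (gt_mem_nhds (sub_pos.2 ha))
    have hε2 := h0.eventually (gt_mem_nhds (sub_pos.2 hb))
    obtain ⟨n, hn⟩ := eventually_atTop.1 hev
    obtain ⟨m, hm, hm1, hm2⟩ := ((eventually_ge_atTop n).and (hε1.and hε2)).exists
    refine ⟨m, fun k => ?_⟩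
    have h := hn (m + k) (by omega)
    exact ⟨by linarith [h.1], by linarith [h.2]⟩
  · rintro ⟨n, hn⟩
    have hmem : f x ∈ Set.Icc (a + 1 / ((n : ℝ) + 1)) (b - 1 / ((n : ℝ) + 1)) := by
      refine isClosed_Icc.mem_of_tendsto hx (eventually_atTop.2 ⟨n, fun m hm => ?_⟩)
      obtain ⟨k, rfl⟩ := Nat.exists_eq_add_of_le hm
      exact hn k
    have hpos : (0 : ℝ) < 1 / ((n : ℝ) + 1) := Nat.one_div_pos_of_nat
    exact ⟨by linarith [hmem.1], by linarith [hmem.2]⟩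

/-- If every zero-set is a countable union of intersections of zero-sets of members of `G`, then
a function of Baire class 1 is, up to `ε`, constant on each member of a countable cover by such
intersections. -/
theorem exists_cover_of_mem_BaireOneSet {G : Set C(X, ℝ)}
    (hG : ∀ Z : Set X, IsZeroSetOf Z → ∃ p : ℕ → ℕ → C(X, ℝ), (∀ n k, p n k ∈ G) ∧
      ∀ x, x ∈ Z ↔ ∃ n, ∀ k, p n k x = 0)
    {f : X → ℝ} (hf : f ∈ BaireOneSet X) {ε : ℝ} (hε : 0 < ε) :
    ∃ (p : ℕ → ℕ → C(X, ℝ)) (v : ℕ → ℚ), (∀ n k, p n k ∈ G) ∧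
      (∀ x, ∃ n, ∀ k, p n k x = 0) ∧
      ∀ n x, (∀ k, p n k x = 0) → |(v n : ℝ) - f x| < ε := by
  choose Z hZ hZf using fun q : ℚ => exists_isZeroSetOf_preimage_Ioo hf (q - ε) (q + ε)
  choose p hpG hp using fun q n => hG (Z q n) (hZ q n)
  obtain ⟨e, he⟩ := exists_surjective_nat (ℚ × ℕ × ℕ)
  refine ⟨fun n => p (e n).1 (e n).2.1 (e n).2.2, fun n => (e n).1, fun n k => hpG _ _ _ _,
    fun x => ?_, fun n x hx => ?_⟩
  · obtain ⟨q, hq1, hq2⟩ := exists_rat_btwn (show f x - ε < f x + ε by linarith)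
    have hq : ∃ q : ℚ, f x ∈ Set.Ioo ((q : ℝ) - ε) (q + ε) :=
      ⟨q, by linarith, by linarith⟩
    obtain ⟨q, hq⟩ := hq
    have hmem : x ∈ ⋃ n, Z q n := by
      rw [← hZf q]
      exact hq
    obtain ⟨i, hi⟩ := Set.mem_iUnion.1 hmem
    obtain ⟨j, hj⟩ := (hp q i x).1 hi
    obtain ⟨n, hn⟩ := he (q, i, j)
    exact ⟨n, by simpa only [hn] using hj⟩
  · have hmem : x ∈ f ⁻¹' Set.Ioo (((e n).1 : ℝ) - ε) ((e n).1 + ε) := by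
      rw [hZf]
      exact Set.mem_iUnion.2 ⟨_, (hp _ _ x).2 ⟨_, hx⟩⟩
    rw [abs_sub_lt_iff]
    exact ⟨by linarith [hmem.1], by linarith [hmem.2]⟩

end ZeroSets

section Approximation

variable {X : Type*} [TopologicalSpace X] {S : Subring C(X, ℝ)}

theorem Subring.inf_mem_of_sup_mem (hsup : ∀ a ∈ S, ∀ b ∈ S, a ⊔ b ∈ S) {a b : C(X, ℝ)}
    (ha : a ∈ S) (hb : b ∈ S) : a ⊓ b ∈ S := by
  have h : a ⊓ b = -(-a ⊔ -b) := by
    ext x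
    simp [max_neg_neg]
  rw [h]
  exact S.neg_mem (hsup _ (S.neg_mem ha) _ (S.neg_mem hb))

/-- The characteristic function of an intersection of zero-sets is the limit of a pointwise
eventually constant sequence of continuous functions. -/
theorem exists_eventually_eq_indicator (hsup : ∀ a ∈ S, ∀ b ∈ S, a ⊔ b ∈ S)
    {p : ℕ → C(X, ℝ)} (hp : ∀ k, p k ∈ S) :
    ∃ u : ℕ → C(X, ℝ), (∀ m, u m ∈ S) ∧ (∀ x, (∀ k, p k x = 0) → ∀ m, u m x = 1) ∧
      ∀ x, ¬ (∀ k, p k x = 0) → ∀ᶠ m in atTop, u m x = 0 := by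
  refine ⟨fun m => 1 - 1 ⊓ ((m : C(X, ℝ)) * ∑ k ∈ Finset.range m, p k ^ 2), fun m => ?_,
    fun x hx m => ?_, fun x hx => ?_⟩
  · exact S.sub_mem S.one_mem (Subring.inf_mem_of_sup_mem hsup S.one_mem
      (S.mul_mem (natCast_mem S m) (S.sum_mem fun k _ => S.pow_mem (hp k) 2)))
  · simp [hx]
  · push Not at hx
    obtain ⟨k, hk⟩ := hx
    have hpos : 0 < p k x ^ 2 := by positivity
    obtain ⟨N, hN⟩ := exists_nat_ge (1 / p k x ^ 2)
    filter_upwards [eventually_ge_atTop N, eventually_gt_atTop k] with m hm hkm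
    have h1 : p k x ^ 2 ≤ ∑ i ∈ Finset.range m, p i x ^ 2 :=
      Finset.single_le_sum (f := fun i => p i x ^ 2) (fun i _ => sq_nonneg _)
        (Finset.mem_range.2 hkm)
    have h2 : 1 / p k x ^ 2 ≤ m := hN.trans (by exact_mod_cast hm)
    have h3 : 1 ≤ (m : ℝ) * ∑ i ∈ Finset.range m, p i x ^ 2 :=
      ((div_le_iff₀ hpos).1 h2).trans (mul_le_mul_of_nonneg_left h1 m.cast_nonneg)
    simp [min_eq_left h3]

/-- A function that is `ε`-close to a constant on each member of a countable cover by
intersections of zero-sets is `ε`-close to the limit of a pointwise eventually constant sequence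
of continuous functions. -/
theorem exists_eventually_eq_of_cover (hsup : ∀ a ∈ S, ∀ b ∈ S, a ⊔ b ∈ S)
    (hconst : ∀ q : ℚ, ContinuousMap.const X (q : ℝ) ∈ S) {f : X → ℝ} {ε : ℝ}
    {p : ℕ → ℕ → C(X, ℝ)} {v : ℕ → ℚ} (hp : ∀ n k, p n k ∈ S)
    (hcover : ∀ x, ∃ n, ∀ k, p n k x = 0)
    (hv : ∀ n x, (∀ k, p n k x = 0) → |(v n : ℝ) - f x| < ε) :
    ∃ s : ℕ → C(X, ℝ), (∀ m, s m ∈ S) ∧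
      ∀ x, ∃ c, |c - f x| < ε ∧ ∀ᶠ m in atTop, s m x = c := by
  classical
  choose u huS hu1 hu0 using fun n => exists_eventually_eq_indicator hsup (hp n)
  -- The product disjointifies the cover: for large `m`, only the first piece containing `x`
  -- contributes at `x`.
  refine ⟨fun m => ∑ n ∈ Finset.range m,
    ContinuousMap.const X (v n : ℝ) * (u n m * ∏ i ∈ Finset.range n, (1 - u i m)), fun m => ?_,
    fun x => ?_⟩
  · exact S.sum_mem fun n _ => S.mul_mem (hconst _) (S.mul_mem (huS n m)
      (S.prod_mem fun i _ => S.sub_mem S.one_mem (huS i m)))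
  · have hx := hcover x
    refine ⟨v (Nat.find hx), hv _ _ (Nat.find_spec hx), ?_⟩
    have hlt : ∀ᶠ m in atTop, ∀ i ∈ Finset.range (Nat.find hx), u i m x = 0 := by
      rw [Filter.eventually_all_finset]
      intro i hi
      exact hu0 i x (Nat.find_min hx (Finset.mem_range.1 hi))
    filter_upwards [hlt, eventually_gt_atTop (Nat.find hx)] with m hm hgt
    simp only [ContinuousMap.sum_apply, ContinuousMap.mul_apply, ContinuousMap.prod_apply,
      ContinuousMap.const_apply, ContinuousMap.sub_apply, ContinuousMap.one_apply]
    rw [Finset.sum_eq_single (Nat.find hx)]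
    · rw [hu1 _ x (Nat.find_spec hx), Finset.prod_eq_one fun i hi => by rw [hm i hi, sub_zero]]
      ring
    · intro n _ hn
      rcases lt_or_gt_of_ne hn with h | h
      · rw [hm n (Finset.mem_range.2 h)]
        ring
      · rw [Finset.prod_eq_zero (Finset.mem_range.2 h)
          (by rw [hu1 _ x (Nat.find_spec hx), sub_self])]
        ring
    · intro h
      exact absurd (Finset.mem_range.2 hgt) h

/-- Iterated sequential limits need not be sequential limits. Here clamping each correction makes
the increments summable uniformly in `m`, so the diagonal converges. -/
theorem exists_tendsto_of_eventually_eq (hsup : ∀ a ∈ S, ∀ b ∈ S, a ⊔ b ∈ S)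
    (hconst : ∀ q : ℚ, ContinuousMap.const X (q : ℝ) ∈ S) {f : X → ℝ}
    (happrox : ∀ ε : ℝ, 0 < ε → ∃ s : ℕ → C(X, ℝ), (∀ m, s m ∈ S) ∧
      ∀ x, ∃ c, |c - f x| < ε ∧ ∀ᶠ m in atTop, s m x = c) :
    ∃ d : ℕ → C(X, ℝ), (∀ m, d m ∈ S) ∧ ∀ x, Tendsto (fun m => d m x) atTop (𝓝 (f x)) := by
  choose s hsS hs using fun k : ℕ => happrox ((1 / 2) ^ k) (by positivity)
  choose c hcf hc using hs
  -- Since `|c (k+1) x - c k x| < 2⁻ᵏ + 2⁻ᵏ⁻¹ < 2 · 2⁻ᵏ`, clamping at this width leaves the eventual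
  -- values unchanged.
  let δ : ℕ → C(X, ℝ) := fun k => ContinuousMap.const X ((2 * (1 / 2) ^ k : ℚ) : ℝ)
  have hδ : ∀ k x, δ k x = 2 * (1 / 2) ^ k := fun k x => by simp [δ]
  let t : ℕ → ℕ → C(X, ℝ) := fun k m =>
    Nat.rec (s 0 m) (fun k t => (t - δ k) ⊔ ((t + δ k) ⊓ s (k + 1) m)) k
  have ht : ∀ k m, t (k + 1) m = (t k m - δ k) ⊔ ((t k m + δ k) ⊓ s (k + 1) m) :=
    fun k m => rfl
  have htx : ∀ k m x, t (k + 1) m x = max (t k m x - 2 * (1 / 2) ^ k)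
      (min (t k m x + 2 * (1 / 2) ^ k) (s (k + 1) m x)) := by
    intro k m x
    rw [ht, ← hδ k x]
    rfl
  have htS : ∀ k m, t k m ∈ S := by
    intro k m
    induction k with
    | zero => exact hsS 0 m
    | succ k ih =>
      rw [ht]
      exact hsup _ (S.sub_mem ih (hconst _)) _
        (Subring.inf_mem_of_sup_mem hsup (S.add_mem ih (hconst _)) (hsS _ _))
  have htc : ∀ x k, ∀ᶠ m in atTop, t k m x = c k x := by
    intro x k
    induction k with
    | zero => exact hc 0 x
    | succ k ih =>
      filter_upwards [ih, hc (k + 1) x] with m h1 h2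
      have h3 := abs_lt.1 (hcf k x)
      have h4 := abs_lt.1 (hcf (k + 1) x)
      rw [pow_succ] at h4
      have hpos : (0 : ℝ) < (1 / 2) ^ k := by positivity
      rw [htx, h1, h2, min_eq_right (by linarith), max_eq_right (by linarith)]
  have hstep : ∀ k m x, |t (k + 1) m x - t k m x| ≤ 2 * (1 / 2) ^ k := by
    intro k m x
    have hpos : (0 : ℝ) < (1 / 2) ^ k := by positivity
    rw [htx, abs_le]
    constructor
    · linarith [le_max_left (t k m x - 2 * (1 / 2) ^ k)
        (min (t k m x + 2 * (1 / 2) ^ k) (s (k + 1) m x))]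
    · have h : max (t k m x - 2 * (1 / 2) ^ k)
          (min (t k m x + 2 * (1 / 2) ^ k) (s (k + 1) m x)) ≤ t k m x + 2 * (1 / 2) ^ k :=
        max_le (by linarith) (min_le_left _ _)
      linarith
  have htail : ∀ k j m x, |t (k + j) m x - t k m x| ≤ 4 * (1 / 2) ^ k - 4 * (1 / 2) ^ (k + j) := by
    intro k j m x
    induction j with
    | zero => simp
    | succ j ih =>
      have h1 := abs_sub_le (t (k + j + 1) m x) (t (k + j) m x) (t k m x)
      have h2 := hstep (k + j) m x
      have h3 : (1 / 2 : ℝ) ^ (k + (j + 1)) = (1 / 2) ^ (k + j) * (1 / 2) := by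
        rw [← add_assoc, pow_succ]
      rw [h3, ← add_assoc]
      linarith
  refine ⟨fun m => t m m, fun m => htS m m, fun x => ?_⟩
  rw [Metric.tendsto_atTop']
  intro ε hε
  -- The total error is below `5 · 2⁻ᵏ`: `4 · 2⁻ᵏ` from the tail and `2⁻ᵏ` from `c k x`.
  obtain ⟨k, hk⟩ := exists_pow_lt_of_lt_one (show (0 : ℝ) < ε / 5 by linarith)
    (show (1 / 2 : ℝ) < 1 by norm_num)
  obtain ⟨N, hN⟩ := eventually_atTop.1 (htc x k)
  refine ⟨max N k, fun m hm => ?_⟩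
  have hNm : N ≤ m := (le_max_left N k).trans hm.le
  obtain ⟨j, rfl⟩ := Nat.exists_eq_add_of_le ((le_max_right N k).trans hm.le)
  have h1 := htail k j (k + j) x
  rw [hN _ hNm] at h1
  have h2 := abs_sub_le (t (k + j) (k + j) x) (c k x) (f x)
  have h3 := hcf k x
  have hpos : (0 : ℝ) < (1 / 2) ^ (k + j) := by positivity
  rw [Real.dist_eq]
  linarith

end Approximation

theorem CpSet_subset_BaireOneSet (X : Type*) [TopologicalSpace X] :
    CpSet X ⊆ BaireOneSet X :=
  fun f hf => ⟨fun _ => f, fun _ => hf, fun _ => tendsto_const_nhds⟩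

/-- A family of functions is sequentially separable if it contains `C(X)` and all its members are
limits of sequences from a fixed countable set of continuous functions. -/
theorem isSequentiallySeparable_of_CpSet_subset {X : Type*} [TopologicalSpace X]
    {S : Set C(X, ℝ)} (hS : S.Countable) {A : Set (X → ℝ)} (hA : CpSet X ⊆ A)
    (hlim : ∀ f ∈ A, ∃ d : ℕ → C(X, ℝ), (∀ m, d m ∈ S) ∧
      ∀ x, Tendsto (fun m => d m x) atTop (𝓝 (f x))) :
    IsSequentiallySeparable A := by
  let i : C(X, ℝ) → A := fun g => ⟨g, hA g.continuous⟩
  refine ⟨i '' S, hS.image i, Set.eq_univ_of_forall fun f => ?_⟩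
  obtain ⟨d, hdS, hd⟩ := hlim f f.2
  refine ⟨fun m => i (d m), fun m => ⟨d m, hdS m, rfl⟩, ?_⟩
  rw [tendsto_subtype_rng, tendsto_pi_nhds]
  exact hd

theorem corollary3p3 (X : Type*) [TopologicalSpace X] [T35Space X]
    (h : IsSequentiallySeparable (USCfSet X)) :
    IsSequentiallySeparable (CpSet X) ∧ IsSequentiallySeparable (BaireOneSet X) := by
  obtain ⟨G, hG, hGZ⟩ := h.exists_countable_generators
  obtain ⟨S, hGS, hS, hsup⟩ := exists_countable_subring_sup
    (hG.union (Set.countable_range fun q : ℚ => ContinuousMap.const X (q : ℝ)))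
  have hconst : ∀ q : ℚ, ContinuousMap.const X (q : ℝ) ∈ S := fun q => hGS (Or.inr ⟨q, rfl⟩)
  have hlim : ∀ f ∈ BaireOneSet X, ∃ d : ℕ → C(X, ℝ), (∀ m, d m ∈ (S : Set C(X, ℝ))) ∧
      ∀ x, Tendsto (fun m => d m x) atTop (𝓝 (f x)) := by
    intro f hf
    refine exists_tendsto_of_eventually_eq hsup hconst fun ε hε => ?_
    obtain ⟨p, v, hpG, hcover, hv⟩ := exists_cover_of_mem_BaireOneSet hGZ hf hε
    exact exists_eventually_eq_of_cover hsup hconst (fun n k => hGS (Or.inl (hpG n k))) hcover hv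
  exact ⟨isSequentiallySeparable_of_CpSet_subset hS subset_rfl
      fun f hf => hlim f (CpSet_subset_BaireOneSet X hf),
    isSequentiallySeparable_of_CpSet_subset hS (CpSet_subset_BaireOneSet X) hlim⟩
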